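/- Let $F$ be a Ferrers shape in French notation, i.e. a finite left- and bottom-justified arrangement of cells whose rows, read from bottom to top, have weakly decreasing lengths, and consider a filling of the cells of $F$ with $0$'s and $1$'s (several $1$'s in a row or column are allowed). Label the corners of the cells of $F$ by partitions according to dual RSK, as follows. Form an augmented diagram: each row (column) containing $r\ge 1$ entries $1$ is replaced by $r$ rows (columns), a row or column without $1$'s is kept, and the $1$'s are replaced by crosses, exactly one cross in each new row and each new column coming from a row or column that contains a $1$, each cross lying in the part of the augmented diagram that comes from the cell of its $1$; here the $1$'s in one column of $F$ are arranged from bottom/left to top/right, while the $1$'s in one row of $F$ are arranged from top/left to bottom/right. Label all corners along the left side and the bottom side of the augmented diagram by the empty partition, and determine all other labels by the forward local rules: for a cell with labels $\rho$ (bottom left), $\mu$ (bottom right), $\nu$ (top left), the label $\lambda$ (top right) is - $\lambda=\rho$ if $\rho=\mu=\nu$ and there is no cross in the cell; - $\lambda=\nu$ if $\rho=\mu\ne\nu$; - $\lambda=\mu$ if $\rho=\nu\ne\mu$; - $\lambda=\mu\cup\nu$ (union of Ferrers diagrams) if $\rho,\mu,\nu$ are pairwise different; - $\mu$ with a square added to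 row $k+1$, if $\rho\ne\mu=\nu$ and $\mu$ and $\rho$ differ in row $k$; - $\rho$ with a square added to the first row, if $\rho=\mu=\nu$ and there is a cross in the cell. Finally, record only the labels at the corners of the original cells. An nE-chain is a sequence of $1$'s of the filling in which each $1$ is strictly above and weakly to the right of the preceding one; a Se-chain is a sequence of $1$'s in which each $1$ is weakly below and strictly to the right of the preceding one. The length of a chain is the number of its $1$'s; the empty chain is allowed. Then the partition $\lambda=(\lambda_1,\lambda_2,\dots)$ labelling a corner $c$ of $F$, with conjugate $\lambda'$, satisfies the following. 1. For every $k$, the maximal cardinality of the union of $k$ nE-chains situated in the rectangular region to the left and below of $c$ is equal to $\lambda_1+\lambda_2+\dots+\lambda_k$. 2. For every $k$, the maximal cardinality of the union of $k$ Se-chains situated in the rectangular region to the left and below of $c$ is equal to $\lambda'_1+\lambda'_2+\dots+\lambda'_k$. In particular, $\lambda_1$ is the length of the longest nE-chain, and $\lambda'_1$ the length of the longest Se-chain, in this rectangular region. -/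

import Mathlib

namespace DualRSK

/-! Ferrers shapes are drawn in French notation: the cell `(i, j)` lies in row `i` counted from the
bottom and in column `j` counted from the left, both starting with `0`. The point `(i, j)` of the
grid is the lower left corner of the cell `(i, j)`. A `0`-`1`-filling of a shape is the finite set
`A` of those of its cells that contain a `1`. Labels (partitions) are Young diagrams: the part
`λ_(t+1)` is `rowLen t`, the part `λ'_(t+1)` of the conjugate is `colLen t`, and the union of two
partitions is `⊔`. -/

/-- `lam` arises from `mu` by adding a square at the end of row `k` (row `0` is the first row). -/
def IsAddSquare (mu : YoungDiagram) (k : ℕ) (lam : YoungDiagram) : Prop :=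
  lam.cells = insert (k, mu.rowLen k) mu.cells

/-- The six forward local rules for a cell with the labels `rho` (bottom left), `mu` (bottom right),
`nu` (top left) and `lam` (top right); `cross` says whether there is a cross in the cell. -/
inductive ForwardRule (cross : Prop) (rho mu nu lam : YoungDiagram) : Prop
  | f1 : rho = mu → mu = nu → ¬ cross → lam = rho → ForwardRule cross rho mu nu lam
  | f2 : rho = mu → mu ≠ nu → lam = nu → ForwardRule cross rho mu nu lam
  | f3 : rho = nu → nu ≠ mu → lam = mu → ForwardRule cross rho mu nu lam
  | f4 : rho ≠ mu → rho ≠ nu → mu ≠ nu → lam = mu ⊔ nu → ForwardRule cross rho mu nu lam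
  | f5 (k : ℕ) : rho ≠ mu → mu = nu → mu.rowLen k ≠ rho.rowLen k → IsAddSquare mu (k + 1) lam →
      ForwardRule cross rho mu nu lam
  | f6 : rho = mu → mu = nu → cross → IsAddSquare rho 0 lam → ForwardRule cross rho mu nu lam

/-- `M` labels the corners of the cells of the arrangement `S` according to the forward local rules,
where `X` is the set of cells with a cross, and the left and the bottom side are labelled by empty
partitions. (The values of `M` at points that are no corners of `S` do not matter.) -/
structure IsGrowthDiagram (S : Set (ℕ × ℕ)) (X : Finset (ℕ × ℕ)) (M : ℕ → ℕ → YoungDiagram) :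
    Prop where
  left : ∀ p, M p 0 = ⊥
  bottom : ∀ q, M 0 q = ⊥
  cell : ∀ p q, (p, q) ∈ S →
    ForwardRule ((p, q) ∈ X) (M p q) (M p (q + 1)) (M (p + 1) q) (M (p + 1) (q + 1))

/-- The number of `1`'s in row `i`. -/
def rowCount (A : Finset (ℕ × ℕ)) (i : ℕ) : ℕ := (A.filter fun e => e.1 = i).card

/-- The number of `1`'s in column `j`. -/
def colCount (A : Finset (ℕ × ℕ)) (j : ℕ) : ℕ := (A.filter fun e => e.2 = j).card

/-- The height of the horizontal line below row `i` in the augmented diagram. There, a row with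
`r ≥ 1` ones is replaced by `r` rows, and a row without ones stays one row. -/
def rowLine (A : Finset (ℕ × ℕ)) (i : ℕ) : ℕ := ∑ a ∈ Finset.range i, max 1 (rowCount A a)

/-- The abscissa of the vertical line left of column `j` in the augmented diagram. -/
def colLine (A : Finset (ℕ × ℕ)) (j : ℕ) : ℕ := ∑ b ∈ Finset.range j, max 1 (colCount A b)

/-- The cells of the augmented diagram: all parts of all cells of `F`. -/
def augmentedShape (F : YoungDiagram) (A : Finset (ℕ × ℕ)) : Set (ℕ × ℕ) :=
  {c | ∃ d ∈ F, (rowLine A d.1 ≤ c.1 ∧ c.1 < rowLine A (d.1 + 1)) ∧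
    (colLine A d.2 ≤ c.2 ∧ c.2 < colLine A (d.2 + 1))}

/-- The cross of the augmented diagram that comes from the `1` in the cell `d`: the `1`'s in a row
are arranged from top/left to bottom/right, those in a column from bottom/left to top/right. -/
def separate (A : Finset (ℕ × ℕ)) (d : ℕ × ℕ) : ℕ × ℕ :=
  (rowLine A d.1 + (A.filter fun e => e.1 = d.1 ∧ d.2 < e.2).card,
    colLine A d.2 + (A.filter fun e => e.2 = d.2 ∧ e.1 < d.1).card)

/-- The point `(i, j)` is a corner of the Ferrers shape `F`: the rectangle to the left and below of
it is contained in `F`. (All points on the two axes are admitted, since a Ferrers shape may have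
rows or columns of length `0`.) -/
def IsCorner (F : YoungDiagram) (i j : ℕ) : Prop := ∀ a < i, ∀ b < j, (a, b) ∈ F

/-- `L` labels the corners of the Ferrers shape `F`, filled by `A`, according to dual RSK, with
empty partitions along the left and the bottom side: `L` is obtained by applying the forward local
rules to the augmented diagram and recording only the labels at the corners of the original
cells. -/
def IsDualRSKDiagram (F : YoungDiagram) (A : Finset (ℕ × ℕ)) (L : ℕ → ℕ → YoungDiagram) : Prop :=
  ∃ M : ℕ → ℕ → YoungDiagram,
    IsGrowthDiagram (augmentedShape F A) (A.image (separate A)) M ∧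
      ∀ i j, IsCorner F i j → L i j = M (rowLine A i) (colLine A j)

/-- `y` is strictly above and weakly to the right of `x`. -/
def StepNE (x y : ℕ × ℕ) : Prop := x.1 < y.1 ∧ x.2 ≤ y.2

/-- `y` is weakly below and strictly to the right of `x`. -/
def StepSE (x y : ℕ × ℕ) : Prop := y.1 ≤ x.1 ∧ x.2 < y.2

/-- `l` is a sequence of `1`'s of the filling `A`, situated in the rectangle to the left and below
of the corner `(i, j)`, in which consecutive members are related by `step`. -/
def IsChainIn (step : ℕ × ℕ → ℕ × ℕ → Prop) (A : Finset (ℕ × ℕ)) (i j : ℕ) (l : List (ℕ × ℕ)) :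
    Prop :=
  l.IsChain step ∧ ∀ x ∈ l, x ∈ A ∧ x.1 < i ∧ x.2 < j

/-- The cardinalities of unions of `k` such chains. -/
def unionSizes (step : ℕ × ℕ → ℕ × ℕ → Prop) (A : Finset (ℕ × ℕ)) (i j k : ℕ) : Set ℕ :=
  {n | ∃ C : Fin k → List (ℕ × ℕ), (∀ t, IsChainIn step A i j (C t)) ∧
    n = (Finset.univ.biUnion fun t => (C t).toFinset).card}

/-- The lengths of such chains. -/
def chainLengths (step : ℕ × ℕ → ℕ × ℕ → Prop) (A : Finset (ℕ × ℕ)) (i j : ℕ) : Set ℕ :=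
  {n | ∃ l : List (ℕ × ℕ), IsChainIn step A i j l ∧ n = l.length}

end DualRSK

namespace DualRSK

/-! The theorem is Greene's theorem for the permutation formed by the crosses, but only half of it
is needed. A nE-chain and a Se-chain share at most one `1` (`add_le_of_mem_unionSizes`), so unions
of `k` chains of one kind and `l` of the other have total size at most the number of `1`'s plus `k *
l`. For a partition of that size, the cells in the first `k` rows and those in the first `l` columns
attain this bound when `(k, l)` is just outside the diagram and the `k` by `l` rectangle inside
(`card_rows_add_card_cols`). Hence it suffices to construct unions of chains of the expected sizes;
their maximality is automatic.

For the construction, the horizontal edges at a fixed height are labelled by the row in which a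
square is added. The columns with label `k` form row `k` of a tableau, and one row of local rules
performs the row insertion of the column of its cross (`ForwardRule.edgeLabel`,
`greeneLE_tableauWord_nextRow`). Row insertion is a sequence of Knuth moves, along which colourings
by monotone subsequences can be transferred. The reading word of the tableau is visibly coloured by
its rows (increasing) and by its columns (decreasing), so the word of the crosses has colourings of
the same sizes (`exists_greeneLE_tableauWord`). Finally, the way `separate` breaks ties turns
increasing sequences of crosses into nE-chains and decreasing ones into Se-chains. -/

/-- The word `w` can be coloured such that the letters of each colour `< k` form an `r`-chain and
exactly `n` letters have a colour `< k`. -/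
def HasColoring {α : Type*} (r : α → α → Prop) (k n : ℕ) (w : List α) : Prop :=
  ∃ cw : List (α × ℕ), cw.map Prod.fst = w ∧
    cw.Pairwise (fun u v => u.2 < k → u.2 = v.2 → r u.1 v.1) ∧ cw.countP (fun u => u.2 < k) = n

/-! ### Knuth moves and colourings by chains -/

section Knuth

variable {α : Type*} {r : α → α → Prop} {k n : ℕ} {a b c : α} {x y : List α}

theorem map_fst_eq_append_three {cw : List (α × ℕ)}
    (h : cw.map Prod.fst = x ++ a :: b :: c :: y) :
    ∃ X s t u Y, cw = X ++ (a, s) :: (b, t) :: (c, u) :: Y ∧ X.map Prod.fst = x ∧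
      Y.map Prod.fst = y := by
  obtain ⟨X, Z, rfl, hX, hZ⟩ := List.map_eq_append_iff.1 h
  obtain ⟨⟨a', s⟩, Z₁, rfl, rfl, h₁⟩ := List.map_eq_cons_iff.1 hZ
  obtain ⟨⟨b', t⟩, Z₂, rfl, rfl, h₂⟩ := List.map_eq_cons_iff.1 h₁
  obtain ⟨⟨c', u⟩, Z₃, rfl, rfl, h₃⟩ := List.map_eq_cons_iff.1 h₂
  exact ⟨X, s, t, u, Z₃, rfl, hX, h₃⟩

theorem swap_lt_iff {s t k : ℕ} (hs : s < k) (ht : t < k) (z : ℕ) :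
    Equiv.swap s t z < k ↔ z < k := by
  rw [Equiv.swap_apply_def]; grind

theorem countP_map_swap {s t : ℕ} (hs : s < k) (ht : t < k) (Y : List (α × ℕ)) :
    (Y.map (Prod.map id (Equiv.swap s t))).countP (fun u => u.2 < k) =
      Y.countP (fun u => u.2 < k) := by
  rw [List.countP_map]
  congr 1
  funext z
  simp [swap_lt_iff hs ht]

/-- Exchanging two chain colours on the rest of the word exchanges the tails of two chains; this is
the recolouring needed in the `unsort` lemmas. -/
theorem pairwise_map_swap {s t : ℕ} (hs : s < k) (ht : t < k) {Y : List (α × ℕ)}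
    (hY : Y.Pairwise (fun u v => u.2 < k → u.2 = v.2 → r u.1 v.1)) :
    (Y.map (Prod.map id (Equiv.swap s t))).Pairwise
      (fun u v => u.2 < k → u.2 = v.2 → r u.1 v.1) := by
  rw [List.pairwise_map]
  refine hY.imp ?_
  intro u v h h1 h2
  exact h ((swap_lt_iff hs ht _).1 h1) ((Equiv.swap s t).injective h2)

variable (htr : ∀ x y z, r x y → r y z → r x z) (hirr : ∀ x, ¬ r x x)
include htr

/-- Every letter keeps its colour: only `a` and `c` change their order, and `r a c` holds. -/
theorem HasColoring.sort_before (hab : r a b) (hbc : r b c)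
    (h : HasColoring r k n (x ++ c :: a :: b :: y)) :
    HasColoring r k n (x ++ a :: c :: b :: y) := by
  obtain ⟨cw, hw, hp, hn⟩ := h
  obtain ⟨X, s, t, u, Y, rfl, rfl, rfl⟩ := map_fst_eq_append_three hw
  refine ⟨X ++ (a, t) :: (c, s) :: (b, u) :: Y, by simp, ?_, ?_⟩
  · have hac := htr _ _ _ hab hbc
    simp only [List.pairwise_append, List.pairwise_cons, List.forall_mem_cons] at hp ⊢
    grind
  · simp only [List.countP_append, List.countP_cons] at hn ⊢
    omega

theorem HasColoring.sort_after (hab : r a b) (hbc : r b c)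
    (h : HasColoring r k n (x ++ b :: c :: a :: y)) :
    HasColoring r k n (x ++ b :: a :: c :: y) := by
  obtain ⟨cw, hw, hp, hn⟩ := h
  obtain ⟨X, s, t, u, Y, rfl, rfl, rfl⟩ := map_fst_eq_append_three hw
  refine ⟨X ++ (b, s) :: (a, u) :: (c, t) :: Y, by simp, ?_, ?_⟩
  · have hac := htr _ _ _ hab hbc
    simp only [List.pairwise_append, List.pairwise_cons, List.forall_mem_cons] at hp ⊢
    grind
  · simp only [List.countP_append, List.countP_cons] at hn ⊢
    omega

include hirr

theorem HasColoring.unsort_before (hab : r a b) (hbc : r b c)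
    (h : HasColoring r k n (x ++ a :: c :: b :: y)) :
    HasColoring r k n (x ++ c :: a :: b :: y) := by
  obtain ⟨cw, hw, hp, hn⟩ := h
  obtain ⟨X, s, t, u, Y, rfl, rfl, rfl⟩ := map_fst_eq_append_three hw
  have hac := htr _ _ _ hab hbc
  have hcb : ¬ r c b := fun h => hirr _ (htr _ _ _ h hbc)
  by_cases hst : s = t ∧ s < k
  · obtain ⟨rfl, hs⟩ := hst
    -- Here `a` and `c` share a chain and can no longer do so. If `b` is in another chain, the tails
    -- after `c` and `b` are exchanged: `a, b` continues with the old tail of `b`, and `c` takes the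
    -- place of `b` with its own tail. If `b` is in no chain, it replaces `c`.
    by_cases hu : u < k
    · refine ⟨X ++ (c, u) :: (a, s) :: (b, s) :: Y.map (Prod.map id (Equiv.swap s u)),
        by simp, ?_, ?_⟩
      · have hY := fun h => pairwise_map_swap (r := r) hs hu (Y := Y) h
        simp only [List.pairwise_append, List.pairwise_cons, List.forall_mem_cons,
          List.forall_mem_map, Prod.map, id, Equiv.swap_apply_def] at hp hY ⊢
        obtain ⟨hX, ⟨h1, h2, h3, h4⟩, h5⟩ := hp
        refine ⟨hX, ⟨?_, ?_, ?_, hY h4⟩, ?_⟩ <;> grind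
      · simp only [List.countP_append, List.countP_cons, countP_map_swap hs hu] at hn ⊢
        omega
    · refine ⟨X ++ (c, u) :: (a, s) :: (b, s) :: Y, by simp, ?_, ?_⟩
      · simp only [List.pairwise_append, List.pairwise_cons, List.forall_mem_cons] at hp ⊢
        grind
      · simp only [List.countP_append, List.countP_cons] at hn ⊢
        omega
  · refine ⟨X ++ (c, t) :: (a, s) :: (b, u) :: Y, by simp, ?_, ?_⟩
    · simp only [List.pairwise_append, List.pairwise_cons, List.forall_mem_cons] at hp ⊢
      grind
    · simp only [List.countP_append, List.countP_cons] at hn ⊢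
      omega

theorem HasColoring.unsort_after (hab : r a b) (hbc : r b c)
    (h : HasColoring r k n (x ++ b :: a :: c :: y)) :
    HasColoring r k n (x ++ b :: c :: a :: y) := by
  obtain ⟨cw, hw, hp, hn⟩ := h
  obtain ⟨X, s, t, u, Y, rfl, rfl, rfl⟩ := map_fst_eq_append_three hw
  have hac := htr _ _ _ hab hbc
  have hba : ¬ r b a := fun h => hirr _ (htr _ _ _ h hab)
  by_cases htu : t = u ∧ t < k
  · obtain ⟨rfl, ht⟩ := htu
    -- The mirror situation: if `b` is in a chain, that chain continues with `c` and the tail of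
    -- `c`, while `a` continues with the old tail of `b`; otherwise `b` replaces `a`.
    by_cases hs : s < k
    · refine ⟨X ++ (b, s) :: (c, s) :: (a, t) :: Y.map (Prod.map id (Equiv.swap s t)),
        by simp, ?_, ?_⟩
      · have hY := fun h => pairwise_map_swap (r := r) hs ht (Y := Y) h
        simp only [List.pairwise_append, List.pairwise_cons, List.forall_mem_cons,
          List.forall_mem_map, Prod.map, id, Equiv.swap_apply_def] at hp hY ⊢
        obtain ⟨hX, ⟨h1, h2, h3, h4⟩, h5⟩ := hp
        refine ⟨hX, ⟨?_, ?_, ?_, hY h4⟩, ?_⟩ <;> grind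
      · simp only [List.countP_append, List.countP_cons, countP_map_swap hs ht, hs, ht] at hn ⊢
        omega
    · refine ⟨X ++ (b, t) :: (c, t) :: (a, s) :: Y, by simp, ?_, ?_⟩
      · simp only [List.pairwise_append, List.pairwise_cons, List.forall_mem_cons] at hp ⊢
        grind
      · simp only [List.countP_append, List.countP_cons] at hn ⊢
        omega
  · refine ⟨X ++ (b, s) :: (c, u) :: (a, t) :: Y, by simp, ?_, ?_⟩
    · simp only [List.pairwise_append, List.pairwise_cons, List.forall_mem_cons] at hp ⊢
      grind
    · simp only [List.countP_append, List.countP_cons] at hn ⊢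
      omega

end Knuth

/-! ### Transfer of colourings along row insertion -/

/-- The words `w` and `w'` have the same length and, in every context, colourings of `w` by
increasing or by decreasing chains can be transferred to `w'`. -/
def GreeneLE (w w' : List ℕ) : Prop :=
  w.length = w'.length ∧ ∀ x y k n,
    (HasColoring (· < ·) k n (x ++ w ++ y) → HasColoring (· < ·) k n (x ++ w' ++ y)) ∧
    (HasColoring (· > ·) k n (x ++ w ++ y) → HasColoring (· > ·) k n (x ++ w' ++ y))

theorem GreeneLE.refl (w : List ℕ) : GreeneLE w w := ⟨rfl, fun _ _ _ _ => ⟨id, id⟩⟩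

theorem GreeneLE.trans {u v w : List ℕ} (h : GreeneLE u v) (h' : GreeneLE v w) : GreeneLE u w :=
  ⟨h.1.trans h'.1, fun x y k n =>
    ⟨(h'.2 x y k n).1 ∘ (h.2 x y k n).1, (h'.2 x y k n).2 ∘ (h.2 x y k n).2⟩⟩

theorem GreeneLE.append_left {w w' : List ℕ} (h : GreeneLE w w') (z : List ℕ) :
    GreeneLE (z ++ w) (z ++ w') :=
  ⟨by simp [h.1], fun x y k n => by simpa using h.2 (x ++ z) y k n⟩

theorem GreeneLE.append_right {w w' : List ℕ} (h : GreeneLE w w') (z : List ℕ) :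
    GreeneLE (w ++ z) (w' ++ z) :=
  ⟨by simp [h.1], fun x y k n => by simpa using h.2 x (z ++ y) k n⟩

theorem GreeneLE.cons {w w' : List ℕ} (h : GreeneLE w w') (z : ℕ) :
    GreeneLE (z :: w) (z :: w') := h.append_left [z]

/-- Such a move sorts a pair with respect to `<` and unsorts it with respect to `>`, or conversely,
so each direction of the move uses one lemma of each type. -/
theorem greeneLE_knuth_before {a b c : ℕ} (hab : a < b) (hbc : b < c) (y : List ℕ) :
    GreeneLE (c :: a :: b :: y) (a :: c :: b :: y) := by
  refine ⟨by simp, fun x z k n => ?_⟩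
  simp only [List.append_assoc, List.cons_append]
  exact ⟨HasColoring.sort_before (fun _ _ _ => lt_trans) hab hbc,
    HasColoring.unsort_before (fun _ _ _ h h' => lt_trans h' h) (fun _ => lt_irrefl _) hbc hab⟩

theorem greeneLE_knuth_after {a b c : ℕ} (hab : a < b) (hbc : b < c) (y : List ℕ) :
    GreeneLE (b :: a :: c :: y) (b :: c :: a :: y) := by
  refine ⟨by simp, fun x z k n => ?_⟩
  simp only [List.append_assoc, List.cons_append]
  exact ⟨HasColoring.unsort_after (fun _ _ _ => lt_trans) (fun _ => lt_irrefl _) hab hbc,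
    HasColoring.sort_after (fun _ _ _ h h' => lt_trans h' h) hbc hab⟩

/-- The letter `b` passes the letters of `u` one by one; the letter that follows, in `u` or `c`
itself, is the witness of intermediate size for the Knuth move. -/
theorem greeneLE_move_bumped {b c : ℕ} (hcb : c < b) : ∀ {u : List ℕ},
    u.Pairwise (· < ·) → (∀ a ∈ u, a < c) → GreeneLE (b :: (u ++ [c])) (u ++ [b, c])
  | [], _, _ => GreeneLE.refl _
  | a :: u, hu, huc => by
    have ih := (greeneLE_move_bumped hcb (List.pairwise_cons.1 hu).2
      fun z hz => huc z (List.mem_cons_of_mem _ hz)).cons a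
    refine GreeneLE.trans ?_ ih
    have hac := huc a (by simp)
    cases u with
    | nil => exact greeneLE_knuth_before hac hcb []
    | cons d u =>
      exact greeneLE_knuth_before ((List.pairwise_cons.1 hu).1 d (by simp))
        ((huc d (by simp)).trans hcb) _

/-- The letter `c` passes the letters of `v` one by one, the witness being the letter just before
the pair. -/
theorem greeneLE_move_inserted {c : ℕ} : ∀ {v : List ℕ} {b : ℕ}, c < b →
    (b :: v).Pairwise (· < ·) → GreeneLE (b :: c :: v) (b :: (v ++ [c]))
  | [], _, _, _ => GreeneLE.refl _
  | d :: v, b, hcb, h => by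
    have hbd := (List.pairwise_cons.1 h).1 d (by simp)
    exact (greeneLE_knuth_after hcb hbd v).trans
      ((greeneLE_move_inserted (hcb.trans hbd) (List.pairwise_cons.1 h).2).cons b)

/-- Row insertion of `c` into the row `u b v` bumps `b`. -/
theorem greeneLE_row_insertion {b c : ℕ} {u v : List ℕ} (huc : ∀ a ∈ u, a < c) (hcb : c < b)
    (h : (u ++ b :: v).Pairwise (· < ·)) :
    GreeneLE (b :: (u ++ c :: v)) (u ++ b :: v ++ [c]) := by
  have h1 := (greeneLE_move_bumped hcb (List.pairwise_append.1 h).1 huc).append_right v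
  have h2 := (greeneLE_move_inserted hcb (List.pairwise_append.1 h).2.1).append_left u
  simp only [List.append_assoc, List.cons_append, List.nil_append] at h1 h2 ⊢
  exact h1.trans h2

/-! ### One row of a growth diagram as a row insertion -/

section Row

open Classical in
/-- The labels of the vertical edges of one row of cells, given the labels `h` of the horizontal
edges below it. The label `0` stands for equal partitions at both ends, the label `k + 1` for a
square added to row `k`. -/
noncomputable def rowState (x : ℕ → Prop) (h : ℕ → ℕ) : ℕ → ℕ
  | 0 => 0
  | c + 1 => if h c = rowState x h c ∧ (h c ≠ 0 ∨ x c) then h c + 1 else rowState x h c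

open Classical in
/-- The labels of the horizontal edges above a row of cells. -/
noncomputable def nextRow (x : ℕ → Prop) (h : ℕ → ℕ) (c : ℕ) : ℕ :=
  if h c = rowState x h c ∧ (h c ≠ 0 ∨ x c) then h c + 1 else h c

/-- The columns `< Q` whose label is `k`. -/
def tableauRow (Q : ℕ) (h : ℕ → ℕ) (k : ℕ) : List ℕ := (List.range Q).filter fun c => h c = k

/-- The rows `N, …, 1` of a tableau, read one after the other. -/
def tableauWord (Q : ℕ) (h : ℕ → ℕ) : ℕ → List ℕ
  | 0 => []
  | N + 1 => tableauRow Q h (N + 1) ++ tableauWord Q h N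

variable {x : ℕ → Prop} {h : ℕ → ℕ} {Q : ℕ}

/-- The first alternative is a bump: column `c` moves from row `h c` of the tableau to row `h c + 1`
(row `0` meaning absence), and the state follows. -/
theorem rowState_succ_cases (x : ℕ → Prop) (h : ℕ → ℕ) (c : ℕ) :
    ((h c = rowState x h c ∧ (h c ≠ 0 ∨ x c)) ∧ rowState x h (c + 1) = rowState x h c + 1 ∧
      nextRow x h c = h c + 1) ∨
    (¬ (h c = rowState x h c ∧ (h c ≠ 0 ∨ x c)) ∧ rowState x h (c + 1) = rowState x h c ∧
      nextRow x h c = h c) := by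
  by_cases hb : h c = rowState x h c ∧ (h c ≠ 0 ∨ x c)
  · refine Or.inl ⟨hb, ?_, ?_⟩
    · rw [rowState, if_pos hb, hb.1]
    · rw [nextRow, if_pos hb]
  · refine Or.inr ⟨hb, ?_, ?_⟩
    · rw [rowState, if_neg hb]
    · rw [nextRow, if_neg hb]

theorem rowState_mono (x : ℕ → Prop) (h : ℕ → ℕ) : Monotone (rowState x h) :=
  monotone_nat_of_le_succ fun c => by
    rcases rowState_succ_cases x h c with hc | hc <;> omega

theorem rowState_le (x : ℕ → Prop) (h : ℕ → ℕ) (c : ℕ) : rowState x h c ≤ c := by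
  induction c with
  | zero => simp [rowState]
  | succ c ih => rcases rowState_succ_cases x h c with hc | hc <;> omega

theorem rowState_eq_zero {c : ℕ} (hx : ∀ c' < c, ¬ x c') : rowState x h c = 0 := by
  induction c with
  | zero => rfl
  | succ c ih =>
    have h0 := ih fun c' hc' => hx c' (by omega)
    have h1 := hx c (by omega)
    rcases rowState_succ_cases x h c with hc | hc
    · have := hc.1.1
      rcases hc.1.2 with h2 | h2
      · omega
      · exact absurd h2 h1
    · omega

theorem nextRow_eq_self {c : ℕ} (hx : ∀ c' < c + 1, ¬ x c') : nextRow x h c = h c := by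
  have h0 := rowState_eq_zero (h := h) hx
  rcases rowState_succ_cases x h c with hc | hc <;> omega

theorem nextRow_le (x : ℕ → Prop) (h : ℕ → ℕ) (c : ℕ) : nextRow x h c ≤ max (h c) (c + 1) := by
  have := rowState_le x h c
  rcases rowState_succ_cases x h c with hc | hc <;> omega

/-- The state starts at `0` and grows by at most one per cell. The column `e` is the letter that
leaves row `N` and enters row `N + 1`. -/
theorem exists_rowState_step {N : ℕ} : ∀ {c : ℕ}, N < rowState x h c →
    ∃ e < c, rowState x h e = N ∧ rowState x h (e + 1) = N + 1
  | 0, hN => by simp [rowState] at hN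
  | c + 1, hN => by
    by_cases hc : N < rowState x h c
    · obtain ⟨e, he, h1⟩ := exists_rowState_step hc
      exact ⟨e, by omega, h1⟩
    · refine ⟨c, by omega, ?_⟩
      rcases rowState_succ_cases x h c with hc | hc <;> omega

theorem range_eq_append_cons {e Q : ℕ} (he : e < Q) :
    List.range Q = List.range e ++ e :: List.range' (e + 1) (Q - (e + 1)) := by
  have h1 : e :: List.range' (e + 1) (Q - (e + 1)) = List.range' e (Q - e) := by
    rw [show Q - e = (Q - (e + 1)) + 1 by omega, List.range'_succ]
  have h2 := List.range'_append_1 (s := 0) (m := e) (n := Q - e)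
  rw [zero_add, Nat.add_sub_cancel' he.le] at h2
  rw [h1, List.range_eq_range', List.range_eq_range', h2]

theorem pairwise_tableauRow (Q : ℕ) (h : ℕ → ℕ) (k : ℕ) :
    (tableauRow Q h k).Pairwise (· < ·) :=
  List.pairwise_lt_range.filter _

theorem tableauRow_congr {h' : ℕ → ℕ} {k : ℕ} (hh : ∀ c < Q, h' c = k ↔ h c = k) :
    tableauRow Q h' k = tableauRow Q h k :=
  List.filter_congr fun c hc => by simp [hh c (List.mem_range.1 hc)]

theorem tableauWord_congr {h' : ℕ → ℕ} (hh : ∀ c < Q, h' c = h c) (N : ℕ) :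
    tableauWord Q h' N = tableauWord Q h N := by
  induction N with
  | zero => rfl
  | succ N ih =>
    rw [tableauWord, tableauWord, ih, tableauRow_congr fun c hc => by rw [hh c hc]]

theorem tableauRow_nextRow_of_lt {k : ℕ} (hk : rowState x h Q < k) :
    tableauRow Q (nextRow x h) k = tableauRow Q h k := by
  refine tableauRow_congr fun c hc => ?_
  have := rowState_mono x h (show c + 1 ≤ Q from hc)
  rcases rowState_succ_cases x h c with hc | hc <;> omega

/-- The insertion ends in this row: a column with label `k + 1` to the right of `e` would be bumped
and raise the state further, so `e` comes last. -/
theorem tableauRow_nextRow_of_eq {k e : ℕ} (hk : rowState x h Q = k + 1) (heQ : e < Q)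
    (he : rowState x h e = k) (he' : rowState x h (e + 1) = k + 1) :
    tableauRow Q (nextRow x h) (k + 1) = tableauRow Q h (k + 1) ++ [e] := by
  have h1 : (List.range e).filter (fun c => nextRow x h c = k + 1) =
      (List.range e).filter (fun c => h c = k + 1) := by
    refine tableauRow_congr fun c hc => ?_
    have := rowState_mono x h (show c + 1 ≤ e from hc)
    rcases rowState_succ_cases x h c with hc | hc <;> omega
  have h2 : ∀ c ∈ List.range' (e + 1) (Q - (e + 1)), h c ≠ k + 1 ∧ nextRow x h c ≠ k + 1 := by
    intro c hc
    rw [List.mem_range'_1] at hc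
    have h3 := rowState_mono x h hc.1
    have h4 := rowState_mono x h (show c + 1 ≤ Q by omega)
    rcases rowState_succ_cases x h c with hc | hc <;> omega
  have h3 : h e ≠ k + 1 ∧ nextRow x h e = k + 1 := by
    rcases rowState_succ_cases x h e with hc | hc <;> omega
  have h4 : (List.range' (e + 1) (Q - (e + 1))).filter (fun c => h c = k + 1) = [] :=
    List.filter_eq_nil_iff.2 fun c hc => by simpa using (h2 c hc).1
  have h5 : (List.range' (e + 1) (Q - (e + 1))).filter (fun c => nextRow x h c = k + 1) = [] :=
    List.filter_eq_nil_iff.2 fun c hc => by simpa using (h2 c hc).2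
  rw [tableauRow, tableauRow, range_eq_append_cons heQ]
  simp only [List.filter_append, List.filter_cons, h1, h3]
  rw [h4, h5]
  simp

/-- Between `e` and `e'` no column has label `k + 1`, as it would be bumped earlier. So `e` takes
the position of `e'`, which is one step of row insertion. -/
theorem greeneLE_tableauRow_nextRow {k e e' : ℕ} (heQ : e' < Q)
    (he : rowState x h e = k) (he1 : rowState x h (e + 1) = k + 1)
    (he2 : rowState x h e' = k + 1) (he3 : rowState x h (e' + 1) = k + 2) :
    GreeneLE (e' :: tableauRow Q (nextRow x h) (k + 1)) (tableauRow Q h (k + 1) ++ [e]) := by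
  have hee : e < e' := by
    by_contra hc
    have := rowState_mono x h (not_lt.1 hc)
    omega
  have h1 : (List.range e).filter (fun c => nextRow x h c = k + 1) =
      (List.range e).filter (fun c => h c = k + 1) := by
    refine tableauRow_congr fun c hc => ?_
    have := rowState_mono x h (show c + 1 ≤ e from hc)
    rcases rowState_succ_cases x h c with hc | hc <;> omega
  have h2 : ∀ c ∈ List.range' (e + 1) (e' - (e + 1)), h c ≠ k + 1 ∧ nextRow x h c ≠ k + 1 := by
    intro c hc
    rw [List.mem_range'_1] at hc
    have h3 := rowState_mono x h hc.1
    have h4 := rowState_mono x h (show c + 1 ≤ e' by omega)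
    rcases rowState_succ_cases x h c with hc | hc <;> omega
  have h3 : h e ≠ k + 1 ∧ nextRow x h e = k + 1 := by
    rcases rowState_succ_cases x h e with hc | hc <;> omega
  have h4 : h e' = k + 1 ∧ nextRow x h e' ≠ k + 1 := by
    rcases rowState_succ_cases x h e' with hc | hc <;> omega
  have h5 : (List.range' (e' + 1) (Q - (e' + 1))).filter (fun c => nextRow x h c = k + 1) =
      (List.range' (e' + 1) (Q - (e' + 1))).filter (fun c => h c = k + 1) := by
    refine List.filter_congr fun c hc => ?_
    rw [List.mem_range'_1] at hc
    have := rowState_mono x h hc.1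
    have h6 : nextRow x h c = k + 1 ↔ h c = k + 1 := by
      rcases rowState_succ_cases x h c with hc | hc <;> omega
    simp [h6]
  have h6 : (List.range' (e + 1) (e' - (e + 1))).filter (fun c => h c = k + 1) = [] :=
    List.filter_eq_nil_iff.2 fun c hc => by simpa using (h2 c hc).1
  have h7 : (List.range' (e + 1) (e' - (e + 1))).filter (fun c => nextRow x h c = k + 1) = [] :=
    List.filter_eq_nil_iff.2 fun c hc => by simpa using (h2 c hc).2
  have hu : tableauRow Q h (k + 1) = (List.range e).filter (fun c => h c = k + 1) ++
      e' :: (List.range' (e' + 1) (Q - (e' + 1))).filter (fun c => h c = k + 1) := by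
    rw [tableauRow, range_eq_append_cons heQ, range_eq_append_cons hee]
    simp only [List.filter_append, List.filter_cons, h3, h4]
    rw [h6]
    simp
  have hv : tableauRow Q (nextRow x h) (k + 1) =
      (List.range e).filter (fun c => h c = k + 1) ++
      e :: (List.range' (e' + 1) (Q - (e' + 1))).filter (fun c => h c = k + 1) := by
    rw [tableauRow, range_eq_append_cons heQ, range_eq_append_cons hee]
    simp only [List.filter_append, List.filter_cons, h1, h3, h4, h5]
    rw [h7]
    simp
  have hs := pairwise_tableauRow Q h (k + 1)
  rw [hu] at hs
  rw [hu, hv]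
  exact greeneLE_row_insertion (fun a ha => List.mem_range.1 (List.mem_filter.1 ha).1) hee hs

/-- The two claims treat an insertion that has ended within the first `N` rows and one that bumps
`e` out of row `N`; in the latter case `e` stands in front of the word, ready to enter row `N + 1`.
-/
theorem greeneLE_tableauWord_nextRow {c₀ : ℕ} (hc₀ : c₀ < Q) (hx : x c₀)
    (hx' : ∀ c < Q, x c → c = c₀) (h0 : h c₀ = 0) (N : ℕ) :
    (rowState x h Q ≤ N →
      GreeneLE (tableauWord Q (nextRow x h) N) (tableauWord Q h N ++ [c₀])) ∧
    (∀ e < Q, rowState x h e = N → rowState x h (e + 1) = N + 1 →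
      GreeneLE (e :: tableauWord Q (nextRow x h) N) (tableauWord Q h N ++ [c₀])) := by
  have hs0 : rowState x h c₀ = 0 :=
    rowState_eq_zero fun c hc hxc => hc.ne (hx' c (hc.trans hc₀) hxc)
  have hs1 : rowState x h (c₀ + 1) = 1 := by
    rw [rowState, if_pos ⟨h0.trans hs0.symm, Or.inr hx⟩, h0]
  induction N with
  | zero =>
    -- The cross makes the state positive, so the first claim is vacuous; the step from `0` to `1`
    -- happens only at the cross.
    have := rowState_mono x h (show c₀ + 1 ≤ Q from hc₀)
    refine ⟨fun hQ => by omega, fun e he h1 h2 => ?_⟩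
    have : e = c₀ := by
      rcases lt_trichotomy e c₀ with hlt | heq | hgt
      · have := rowState_mono x h (show e + 1 ≤ c₀ from hlt)
        omega
      · exact heq
      · have := rowState_mono x h (show c₀ + 1 ≤ e from hgt)
        omega
    subst this
    exact GreeneLE.refl _
  | succ N ih =>
    constructor
    · intro hQ
      rw [tableauWord, tableauWord, List.append_assoc]
      rcases Nat.lt_or_ge (rowState x h Q) (N + 1) with hlt | hge
      · rw [tableauRow_nextRow_of_lt hlt]
        exact (ih.1 (by omega)).append_left _
      · obtain ⟨e, heQ, he, he'⟩ := exists_rowState_step (show N < rowState x h Q by omega)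
        rw [tableauRow_nextRow_of_eq (by omega) heQ he he', List.append_assoc]
        exact (ih.2 e heQ he he').append_left _
    · intro e' heQ he2 he3
      obtain ⟨e, hee, he, he1⟩ := exists_rowState_step (show N < rowState x h e' by omega)
      have h1 := (greeneLE_tableauRow_nextRow heQ he he1 he2 he3).append_right
        (tableauWord Q (nextRow x h) N)
      have h2 := (ih.2 e (hee.trans heQ) he he1).append_left (tableauRow Q h (N + 1))
      simp only [List.append_assoc, List.cons_append, List.nil_append, tableauWord] at h1 h2 ⊢
      exact h1.trans h2

theorem mem_tableauWord {N c : ℕ} :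
    c ∈ tableauWord Q h N ↔ c < Q ∧ h c ≠ 0 ∧ h c ≤ N := by
  induction N with
  | zero => simp [tableauWord]
  | succ N ih =>
    simp only [tableauWord, tableauRow, List.mem_append, ih, List.mem_filter, List.mem_range,
      decide_eq_true_eq]
    omega

theorem pairwise_tableauWord (Q : ℕ) (h : ℕ → ℕ) (N : ℕ) :
    (tableauWord Q h N).Pairwise (fun c c' => (h c = h c' ∧ c < c') ∨ h c' < h c) := by
  induction N with
  | zero => simp [tableauWord]
  | succ N ih =>
    rw [tableauWord, List.pairwise_append]
    refine ⟨(pairwise_tableauRow Q h (N + 1)).imp_of_mem ?_, ih, ?_⟩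
    · intro c c' hc hc' hlt
      simp only [tableauRow, List.mem_filter, decide_eq_true_eq] at hc hc'
      exact Or.inl ⟨by omega, hlt⟩
    · intro c hc c' hc'
      simp only [tableauRow, List.mem_filter, decide_eq_true_eq] at hc
      have := (mem_tableauWord.1 hc').2.2
      exact Or.inr (by omega)

theorem nodup_tableauWord (Q : ℕ) (h : ℕ → ℕ) (N : ℕ) : (tableauWord Q h N).Nodup :=
  (pairwise_tableauWord Q h N).imp fun {c c'} hc => by rintro rfl; omega

theorem countP_tableauWord {N : ℕ} (hN : ∀ c < Q, h c ≤ N) (p : ℕ → Prop) [DecidablePred p] :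
    (tableauWord Q h N).countP (fun c => p c) =
      ((Finset.range Q).filter fun c => h c ≠ 0 ∧ p c).card := by
  rw [List.countP_eq_length_filter,
    ← List.toFinset_card_of_nodup ((nodup_tableauWord Q h N).filter _)]
  congr 1
  ext c
  simp only [List.mem_toFinset, List.mem_filter, mem_tableauWord, Finset.mem_filter,
    Finset.mem_range, decide_eq_true_eq]
  have := hN c
  tauto

end Row

/-! ### The labels of a growth diagram -/

/-- The edge from `mu` to `lam` has the label `a`: either `a = 0` and the partitions are equal, or
`a = k + 1` and `lam` arises from `mu` by adding a square to row `k`. -/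
def EdgeLabel (mu lam : YoungDiagram) (a : ℕ) : Prop :=
  ∀ r, lam.rowLen r = mu.rowLen r + if r + 1 = a then 1 else 0

theorem youngDiagram_ext {mu nu : YoungDiagram} (h : ∀ r, mu.rowLen r = nu.rowLen r) :
    mu = nu := by
  ext ⟨r, c⟩
  rw [YoungDiagram.mem_cells, YoungDiagram.mem_cells, YoungDiagram.mem_iff_lt_rowLen,
    YoungDiagram.mem_iff_lt_rowLen, h]

theorem rowLen_sup (mu nu : YoungDiagram) (r : ℕ) :
    (mu ⊔ nu).rowLen r = max (mu.rowLen r) (nu.rowLen r) := by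
  refine eq_of_forall_lt_iff fun c => ?_
  rw [← YoungDiagram.mem_iff_lt_rowLen, YoungDiagram.mem_sup, YoungDiagram.mem_iff_lt_rowLen,
    YoungDiagram.mem_iff_lt_rowLen, lt_max_iff]

theorem edgeLabel_self (mu : YoungDiagram) : EdgeLabel mu mu 0 := fun r => by simp

theorem EdgeLabel.eq_iff {mu lam : YoungDiagram} {a : ℕ} (h : EdgeLabel mu lam a) :
    mu = lam ↔ a = 0 := by
  constructor
  · rintro rfl
    by_contra ha
    have := h (a - 1)
    rw [if_pos (by omega)] at this
    omega
  · rintro rfl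
    exact youngDiagram_ext fun r => by simp [h r]

theorem IsAddSquare.edgeLabel {mu lam : YoungDiagram} {k : ℕ} (h : IsAddSquare mu k lam) :
    EdgeLabel mu lam (k + 1) := by
  intro r
  refine eq_of_forall_lt_iff fun c => ?_
  rw [← YoungDiagram.mem_iff_lt_rowLen, ← YoungDiagram.mem_cells, h, Finset.mem_insert,
    YoungDiagram.mem_cells, YoungDiagram.mem_iff_lt_rowLen, Prod.mk.injEq]
  by_cases hr : r = k
  · subst hr
    simp
    omega
  · simp [hr]

theorem EdgeLabel.cells_eq {mu lam : YoungDiagram} {k : ℕ} (h : EdgeLabel mu lam (k + 1)) :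
    lam.cells = insert (k, mu.rowLen k) mu.cells := by
  ext ⟨r, c⟩
  rw [Finset.mem_insert, YoungDiagram.mem_cells, YoungDiagram.mem_cells,
    YoungDiagram.mem_iff_lt_rowLen, YoungDiagram.mem_iff_lt_rowLen, h r, Prod.mk.injEq]
  by_cases hr : r = k
  · subst hr
    simp
    omega
  · simp [hr]

open Classical in
-- In terms of edge labels the six rules become one: opposite edges carry equal labels, except that
-- two equal labels, nonzero or at a cross, both increase by one.
theorem ForwardRule.edgeLabel {cross : Prop} {rho mu nu lam : YoungDiagram} {a b : ℕ}
    (h : ForwardRule cross rho mu nu lam) (ha : EdgeLabel rho mu a) (hb : EdgeLabel rho nu b)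
    (hx : cross → a = 0 ∧ b = 0) :
    EdgeLabel nu lam (if a = b ∧ (a ≠ 0 ∨ cross) then a + 1 else a) ∧
      EdgeLabel mu lam (if a = b ∧ (a ≠ 0 ∨ cross) then a + 1 else b) := by
  have hab : mu = nu → a = b := by
    rintro rfl
    by_contra hab
    rcases Nat.eq_zero_or_pos a with h0 | h0
    · have h1 := ha (b - 1)
      have h2 := hb (b - 1)
      rw [if_pos (by omega)] at h2
      rw [if_neg (by omega)] at h1
      omega
    · have h1 := ha (a - 1)
      have h2 := hb (a - 1)
      rw [if_neg (by omega)] at h2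
      rw [if_pos (by omega)] at h1
      omega
  have hab' : a = b → mu = nu := by
    rintro rfl
    exact youngDiagram_ext fun r => by rw [ha r, hb r]
  cases h with
  | f1 h1 h2 h3 h4 =>
    have ha0 := ha.eq_iff.1 h1
    have hb0 := hb.eq_iff.1 (h1.trans h2)
    subst ha0 hb0 h4 h1 h2
    simpa [h3] using edgeLabel_self lam
  | f2 h1 h2 h3 =>
    have ha0 := ha.eq_iff.1 h1
    have hb0 : a ≠ b := fun h => h2 (hab' h)
    subst h3 h1
    rw [if_neg (by tauto), if_neg (by tauto), ha0]
    exact ⟨edgeLabel_self _, hb⟩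
  | f3 h1 h2 h3 =>
    have hb0 := hb.eq_iff.1 h1
    have ha0 : a ≠ b := fun h => h2 (hab' h).symm
    subst h3 h1
    rw [if_neg (by tauto), if_neg (by tauto), hb0]
    exact ⟨ha, edgeLabel_self _⟩
  | f4 h1 h2 h3 h4 =>
    have hne : a ≠ b := fun h => h3 (hab' h)
    subst h4
    rw [if_neg (by tauto), if_neg (by tauto)]
    constructor
    · intro r
      rw [rowLen_sup, ha r, hb r]
      split_ifs <;> omega
    · intro r
      rw [rowLen_sup, ha r, hb r]
      split_ifs <;> omega
  | f5 k h1 h2 h3 h4 =>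
    have ha0 : a ≠ 0 := fun h => h1 (ha.eq_iff.2 h)
    have hk : a = k + 1 := by
      by_contra hk
      exact h3 (by rw [ha k, if_neg (by omega), add_zero])
    have heq := hab h2
    subst h2
    rw [if_pos ⟨heq, Or.inl ha0⟩, if_pos ⟨heq, Or.inl ha0⟩, hk]
    exact ⟨h4.edgeLabel, h4.edgeLabel⟩
  | f6 h1 h2 h3 h4 =>
    have ha0 := ha.eq_iff.1 h1
    have heq := hab h2
    subst h2 h1
    rw [if_pos ⟨heq, Or.inr h3⟩, if_pos ⟨heq, Or.inr h3⟩, ha0]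
    exact ⟨h4.edgeLabel, h4.edgeLabel⟩

/-- The labels of the horizontal edges of the growth diagram with the crosses `X`: `edgeRow X p c`
belongs to the edge from `(p, c)` to `(p, c + 1)`. -/
noncomputable def edgeRow (X : Finset (ℕ × ℕ)) : ℕ → ℕ → ℕ
  | 0 => fun _ => 0
  | p + 1 => nextRow (fun c => (p, c) ∈ X) (edgeRow X p)

/-- No two elements of `X` lie in the same row or in the same column. -/
def IsPartialPermutation (X : Finset (ℕ × ℕ)) : Prop :=
  ∀ d ∈ X, ∀ e ∈ X, d.1 = e.1 ∨ d.2 = e.2 → d = e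

section Diagram

variable {X : Finset (ℕ × ℕ)} {M : ℕ → ℕ → YoungDiagram} {S : Set (ℕ × ℕ)} {P Q : ℕ}

theorem edgeRow_eq_zero {p c : ℕ} (hX : ∀ p' < p, (p', c) ∉ X) : edgeRow X p c = 0 := by
  induction p with
  | zero => rfl
  | succ p ih =>
    have h0 := ih fun p' hp' => hX p' (by omega)
    have h1 := hX p (by omega)
    rcases rowState_succ_cases (fun c => (p, c) ∈ X) (edgeRow X p) c with hc | hc
    · rcases hc.1.2 with h2 | h2
      · exact absurd h0 h2
      · exact absurd h2 h1
    · exact hc.2.2.trans h0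

theorem edgeRow_le (X : Finset (ℕ × ℕ)) (p c : ℕ) : edgeRow X p c ≤ c + 1 := by
  induction p with
  | zero => simp [edgeRow]
  | succ p ih =>
    have := nextRow_le (fun c => (p, c) ∈ X) (edgeRow X p) c
    rw [edgeRow]
    omega

theorem IsGrowthDiagram.edgeLabel (hM : IsGrowthDiagram S X M) (hX : IsPartialPermutation X)
    (hS : ∀ p < P, ∀ q < Q, (p, q) ∈ S) : ∀ p ≤ P, ∀ c < Q,
      EdgeLabel (M p c) (M p (c + 1)) (edgeRow X p c) := by
  intro p
  induction p with
  | zero =>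
    intro _ c _
    rw [hM.bottom, hM.bottom]
    exact edgeLabel_self _
  | succ p ih =>
    intro hp
    -- Moving through the row of cells, the vertical label at `c` and the upper horizontal labels to
    -- its left are determined together.
    have key : ∀ c ≤ Q,
        EdgeLabel (M p c) (M (p + 1) c) (rowState (fun c => (p, c) ∈ X) (edgeRow X p) c) ∧
        ∀ c' < c, EdgeLabel (M (p + 1) c') (M (p + 1) (c' + 1)) (edgeRow X (p + 1) c') := by
      intro c
      induction c with
      | zero =>
        intro _
        rw [hM.left, hM.left]
        exact ⟨edgeLabel_self _, by simp⟩
      | succ c ih' =>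
        intro hc
        obtain ⟨h1, h2⟩ := ih' (by omega)
        have h3 := (hM.cell p c (hS p (by omega) c (by omega))).edgeLabel
          (ih (by omega) c (by omega)) h1 fun hx => by
            constructor
            · refine edgeRow_eq_zero fun p' hp' hx' => ?_
              have := hX _ hx _ hx' (Or.inr rfl)
              simp only [Prod.mk.injEq] at this
              omega
            · refine rowState_eq_zero fun c' hc' hx' => ?_
              have := hX _ hx _ hx' (Or.inl rfl)
              simp only [Prod.mk.injEq] at this
              omega
        refine ⟨h3.2, fun c' hc' => ?_⟩
        rcases Nat.lt_succ_iff_lt_or_eq.1 hc' with hlt | rfl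
        · exact h2 c' hlt
        · exact h3.1
    exact (key Q le_rfl).2

/-- The crosses, read from bottom to top, form a word whose colourings include those of the
tableau. -/
theorem exists_greeneLE_tableauWord (hX : IsPartialPermutation X) (Q P : ℕ) :
    ∃ l : List (ℕ × ℕ), l.Pairwise (fun d e => d.1 < e.1) ∧
      (∀ d, d ∈ l ↔ d ∈ X ∧ d.1 < P ∧ d.2 < Q) ∧
      GreeneLE (tableauWord Q (edgeRow X P) Q) (l.map Prod.snd) := by
  induction P with
  | zero =>
    refine ⟨[], List.Pairwise.nil, by simp, ?_⟩
    have : tableauWord Q (edgeRow X 0) Q = [] := by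
      refine List.eq_nil_iff_forall_not_mem.2 fun c hc => ?_
      exact (mem_tableauWord.1 hc).2.1 rfl
    rw [this]
    exact GreeneLE.refl _
  | succ p ih =>
    obtain ⟨l, h1, h2, h3⟩ := ih
    by_cases hc : ∃ c < Q, (p, c) ∈ X
    · obtain ⟨c, hcQ, hc⟩ := hc
      refine ⟨l ++ [(p, c)], ?_, ?_, ?_⟩
      · rw [List.pairwise_append]
        refine ⟨h1, List.pairwise_singleton _ _, fun d hd e he => ?_⟩
        rw [List.mem_singleton.1 he]
        exact ((h2 d).1 hd).2.1
      · intro d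
        rw [List.mem_append, List.mem_singleton, h2]
        constructor
        · rintro (h | rfl)
          · exact ⟨h.1, by omega, h.2.2⟩
          · exact ⟨hc, by simp, hcQ⟩
        · rintro ⟨hd, h4, h5⟩
          by_cases h6 : d.1 = p
          · exact Or.inr (hX _ hd _ hc (Or.inl h6))
          · exact Or.inl ⟨hd, by omega, h5⟩
      · have h4 := (greeneLE_tableauWord_nextRow (x := fun c => (p, c) ∈ X) (h := edgeRow X p)
          hcQ hc (fun c' _ hc' => (Prod.ext_iff.1 (hX _ hc' _ hc (Or.inl rfl))).2)
          (edgeRow_eq_zero fun p' hp' hx' => by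
            have := hX _ hc _ hx' (Or.inr rfl)
            simp only [Prod.mk.injEq] at this
            omega) Q).1 (rowState_le _ _ _)
        rw [List.map_append]
        exact h4.trans (h3.append_right [c])
    · push Not at hc
      refine ⟨l, h1, fun d => ?_, ?_⟩
      · rw [h2]
        constructor
        · exact fun h => ⟨h.1, by omega, h.2.2⟩
        · rintro ⟨hd, h4, h5⟩
          refine ⟨hd, ?_, h5⟩
          rcases Nat.lt_succ_iff_lt_or_eq.1 h4 with h6 | h6
          · exact h6
          · exact absurd (h6 ▸ hd) (hc _ h5)
      · have : tableauWord Q (edgeRow X (p + 1)) Q = tableauWord Q (edgeRow X p) Q :=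
          tableauWord_congr (fun c hcQ => nextRow_eq_self fun c' hc' => hc c' (by omega)) _
        rwa [this]

end Diagram

/-- The cells of the last partition of a sequence correspond to the edges with a label `≠ 0`. -/
theorem card_filter_cells {m : ℕ → YoungDiagram} {h : ℕ → ℕ} {Q : ℕ} (h0 : m 0 = ⊥)
    (hm : ∀ c < Q, EdgeLabel (m c) (m (c + 1)) (h c)) (p : ℕ × ℕ → Prop) [DecidablePred p] :
    ((m Q).cells.filter p).card =
      ((Finset.range Q).filter fun c => h c ≠ 0 ∧ p (h c - 1, (m c).rowLen (h c - 1))).card := by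
  induction Q with
  | zero => simp [h0]
  | succ Q ih =>
    have ih := ih fun c hc => hm c (by omega)
    have hQ := hm Q (by omega)
    rw [Finset.range_add_one, Finset.filter_insert]
    rcases Nat.eq_zero_or_pos (h Q) with hz | hz
    · rw [← hQ.eq_iff.2 hz, ih, if_neg (by omega)]
    · obtain ⟨k, hk⟩ := Nat.exists_eq_succ_of_ne_zero hz.ne'
      rw [hk] at hQ
      rw [hQ.cells_eq, Finset.filter_insert, hk]
      simp only [Nat.succ_eq_add_one, Nat.add_sub_cancel, ne_eq, Nat.add_eq_zero_iff, one_ne_zero,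
        and_false, not_false_eq_true, true_and]
      split_ifs with hp
      · rw [Finset.card_insert_of_notMem, Finset.card_insert_of_notMem, ih]
        · simp
        · simp [YoungDiagram.mem_iff_lt_rowLen]
      · exact ih

/-! ### Colourings of the tableau word by rows and by columns -/

section Colorings

variable {m : ℕ → YoungDiagram} {h : ℕ → ℕ} {Q N : ℕ}

theorem hasColoring_map (r : ℕ → ℕ → Prop) (k : ℕ) (w : List ℕ) (f : ℕ → ℕ)
    (hw : w.Pairwise fun c c' => f c = f c' → r c c') :
    HasColoring r k (w.countP fun c => f c < k) w := by
  refine ⟨w.map fun c => (c, f c), by simp [Function.comp_def], ?_, ?_⟩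
  · rw [List.pairwise_map]
    exact hw.imp fun h _ h' => h h'
  · rw [List.countP_map]
    rfl

variable (h0 : m 0 = ⊥) (hm : ∀ c < Q, EdgeLabel (m c) (m (c + 1)) (h c)) (hN : ∀ c < Q, h c ≤ N)
include h0 hm hN

theorem length_tableauWord : (tableauWord Q h N).length = (m Q).cells.card := by
  have h1 := countP_tableauWord hN (fun _ => True)
  have h2 := card_filter_cells h0 hm (fun _ => True)
  rw [← h1] at h2
  simpa using h2.symm

theorem hasColoring_rows (k : ℕ) : HasColoring (· < ·) k
    ((m Q).cells.filter fun d => d.1 < k).card (tableauWord Q h N) := by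
  rw [card_filter_cells h0 hm, ← countP_tableauWord hN]
  refine hasColoring_map _ _ _ (fun c => h c - 1) ?_
  refine (pairwise_tableauWord Q h N).imp_of_mem ?_
  intro c c' hc hc' hcc heq
  have h1 := (mem_tableauWord.1 hc).2.1
  have h2 := (mem_tableauWord.1 hc').2.1
  omega

/-- The colour of a letter is the column of the square that it adds. Of two squares in one column,
the one in the lower-indexed row is added first but read later in the word, so the letters decrease.
-/
theorem hasColoring_columns (k : ℕ) : HasColoring (· > ·) k
    ((m Q).cells.filter fun d => d.2 < k).card (tableauWord Q h N) := by
  rw [card_filter_cells h0 hm, ← countP_tableauWord hN]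
  refine hasColoring_map _ _ _ (fun c => (m c).rowLen (h c - 1)) ?_
  have hmono : ∀ r c c', c ≤ c' → c' ≤ Q → (m c).rowLen r ≤ (m c').rowLen r := by
    intro r c c' hcc
    induction c', hcc using Nat.le_induction with
    | base => exact fun _ => le_rfl
    | succ c' _ ih =>
      intro hQ
      have := hm c' (by omega) r
      exact (ih (by omega)).trans (by omega)
  have hstep : ∀ c < Q, h c ≠ 0 → (m (c + 1)).rowLen (h c - 1) = (m c).rowLen (h c - 1) + 1 := by
    intro c hc hne
    rw [hm c hc, if_pos (by omega)]
  refine (pairwise_tableauWord Q h N).imp_of_mem ?_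
  intro c c' hc hc' hcc heq
  have heq : (m c).rowLen (h c - 1) = (m c').rowLen (h c' - 1) := heq
  obtain ⟨h1, h2, -⟩ := mem_tableauWord.1 hc
  obtain ⟨h3, h4, -⟩ := mem_tableauWord.1 hc'
  have h5 := hstep c h1 h2
  have h6 := hstep c' h3 h4
  rcases hcc with ⟨h7, h8⟩ | h7
  · have := hmono (h c - 1) (c + 1) c' h8 h3.le
    rw [h7] at this h5 heq
    omega
  · by_contra hlt
    have hne : c ≠ c' := by rintro rfl; omega
    have h8 := hmono (h c - 1) (c + 1) c' (by omega) h3.le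
    have h9 := (m c').rowLen_anti (h c' - 1) (h c - 1) (by omega)
    omega

end Colorings

/-! ### The crosses of the augmented diagram -/

section Separate

variable {A : Finset (ℕ × ℕ)} {d e : ℕ × ℕ} {i j : ℕ}

theorem rowLine_mono (A : Finset (ℕ × ℕ)) : Monotone (rowLine A) :=
  monotone_nat_of_le_succ fun i => by rw [rowLine, rowLine, Finset.sum_range_succ]; omega

theorem colLine_mono (A : Finset (ℕ × ℕ)) : Monotone (colLine A) :=
  monotone_nat_of_le_succ fun i => by rw [colLine, colLine, Finset.sum_range_succ]; omega

theorem separate_fst_lt (hd : d ∈ A) : (separate A d).1 < rowLine A (d.1 + 1) := by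
  have h1 : (A.filter fun e => e.1 = d.1 ∧ d.2 < e.2).card < rowCount A d.1 := by
    refine Finset.card_lt_card (Finset.ssubset_iff_of_subset ?_ |>.2 ⟨d, by simp [hd], by simp⟩)
    intro e he
    simp only [Finset.mem_filter] at he ⊢
    exact ⟨he.1, he.2.1⟩
  simp only [separate, rowLine, Finset.sum_range_succ]
  omega

theorem separate_snd_lt (hd : d ∈ A) : (separate A d).2 < colLine A (d.2 + 1) := by
  have h1 : (A.filter fun e => e.2 = d.2 ∧ e.1 < d.1).card < colCount A d.2 := by
    refine Finset.card_lt_card (Finset.ssubset_iff_of_subset ?_ |>.2 ⟨d, by simp [hd], by simp⟩)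
    intro e he
    simp only [Finset.mem_filter] at he ⊢
    exact ⟨he.1, he.2.1⟩
  simp only [separate, colLine, Finset.sum_range_succ]
  omega

theorem separate_fst_lt_iff (hd : d ∈ A) : (separate A d).1 < rowLine A i ↔ d.1 < i := by
  constructor
  · intro h
    by_contra hi
    have h1 := rowLine_mono A (not_lt.1 hi)
    simp only [separate] at h
    omega
  · exact fun h => (separate_fst_lt hd).trans_le (rowLine_mono A h)

theorem separate_snd_lt_iff (hd : d ∈ A) : (separate A d).2 < colLine A j ↔ d.2 < j := by
  constructor
  · intro h
    by_contra hj
    have h1 := colLine_mono A (not_lt.1 hj)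
    simp only [separate] at h
    omega
  · exact fun h => (separate_snd_lt hd).trans_le (colLine_mono A h)

/-- Crosses from one row descend to the right, so their rows are ordered by row of origin first and
then by decreasing column. -/
theorem separate_fst_lt_separate_fst (hd : d ∈ A)
    (h : d.1 < e.1 ∨ d.1 = e.1 ∧ e.2 < d.2) : (separate A d).1 < (separate A e).1 := by
  rcases h with h | ⟨h, h'⟩
  · exact ((separate_fst_lt_iff hd).2 h).trans_le (Nat.le_add_right _ _)
  · simp only [separate, h]
    refine Nat.add_lt_add_left (Finset.card_lt_card
      (Finset.ssubset_iff_of_subset ?_ |>.2 ⟨d, by simp [hd, h, h'], by simp⟩)) _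
    intro f hf
    simp only [Finset.mem_filter] at hf ⊢
    exact ⟨hf.1, hf.2.1, h'.trans hf.2.2⟩

theorem separate_snd_lt_separate_snd (hd : d ∈ A)
    (h : d.2 < e.2 ∨ d.2 = e.2 ∧ d.1 < e.1) : (separate A d).2 < (separate A e).2 := by
  rcases h with h | ⟨h, h'⟩
  · exact ((separate_snd_lt_iff hd).2 h).trans_le (Nat.le_add_right _ _)
  · simp only [separate, h]
    refine Nat.add_lt_add_left (Finset.card_lt_card
      (Finset.ssubset_iff_of_subset ?_ |>.2 ⟨d, by simp [hd, h, h'], by simp⟩)) _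
    intro f hf
    simp only [Finset.mem_filter] at hf ⊢
    exact ⟨hf.1, hf.2.1, hf.2.2.trans h'⟩

theorem fst_le_of_separate_fst_lt (he : e ∈ A) (h : (separate A d).1 < (separate A e).1) :
    d.1 < e.1 ∨ d.1 = e.1 ∧ e.2 < d.2 := by
  by_contra hc
  by_cases hde : d = e
  · rw [hde] at h
    exact lt_irrefl _ h
  · have h1 := separate_fst_lt_separate_fst (e := d) he (by
      rw [Prod.ext_iff] at hde
      omega)
    omega

theorem snd_le_of_separate_snd_lt (he : e ∈ A) (h : (separate A d).2 < (separate A e).2) :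
    d.2 < e.2 ∨ d.2 = e.2 ∧ d.1 < e.1 := by
  by_contra hc
  by_cases hde : d = e
  · rw [hde] at h
    exact lt_irrefl _ h
  · have h1 := separate_snd_lt_separate_snd (e := d) he (by
      rw [Prod.ext_iff] at hde
      omega)
    omega

theorem eq_of_separate_eq (hd : d ∈ A) (he : e ∈ A)
    (h : (separate A d).1 = (separate A e).1 ∨ (separate A d).2 = (separate A e).2) : d = e := by
  by_contra hde
  rw [Prod.ext_iff] at hde
  rcases h with h | h
  · rcases (show (d.1 < e.1 ∨ d.1 = e.1 ∧ e.2 < d.2) ∨ (e.1 < d.1 ∨ e.1 = d.1 ∧ d.2 < e.2) by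
      omega) with h1 | h1
    · have := separate_fst_lt_separate_fst hd h1
      omega
    · have := separate_fst_lt_separate_fst he h1
      omega
  · rcases (show (d.2 < e.2 ∨ d.2 = e.2 ∧ d.1 < e.1) ∨ (e.2 < d.2 ∨ e.2 = d.2 ∧ e.1 < d.1) by
      omega) with h1 | h1
    · have := separate_snd_lt_separate_snd hd h1
      omega
    · have := separate_snd_lt_separate_snd he h1
      omega

theorem isPartialPermutation_image_separate (A : Finset (ℕ × ℕ)) :
    IsPartialPermutation (A.image (separate A)) := by
  intro d hd e he h
  obtain ⟨d, hd', rfl⟩ := Finset.mem_image.1 hd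
  obtain ⟨e, he', rfl⟩ := Finset.mem_image.1 he
  rw [eq_of_separate_eq hd' he' h]

theorem exists_between_lines {f : ℕ → ℕ} (h0 : f 0 = 0) {p : ℕ} : ∀ {i : ℕ}, p < f i →
    ∃ a < i, f a ≤ p ∧ p < f (a + 1)
  | 0, h => by omega
  | i + 1, h => by
    by_cases hi : p < f i
    · obtain ⟨a, ha, h1⟩ := exists_between_lines h0 hi
      exact ⟨a, by omega, h1⟩
    · exact ⟨i, by omega, not_lt.1 hi, h⟩

theorem mem_augmentedShape {F : YoungDiagram} (hc : IsCorner F i j) {p q : ℕ}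
    (hp : p < rowLine A i) (hq : q < colLine A j) : (p, q) ∈ augmentedShape F A := by
  obtain ⟨a, ha, ha'⟩ := exists_between_lines (by simp [rowLine]) hp
  obtain ⟨b, hb, hb'⟩ := exists_between_lines (by simp [colLine]) hq
  exact ⟨(a, b), hc a ha b hb, ha', hb'⟩

end Separate

/-! ### Unions of chains -/

section Chains

variable {A : Finset (ℕ × ℕ)} {i j k n : ℕ} {step : ℕ × ℕ → ℕ × ℕ → Prop}

theorem exists_map_eq {α β : Type*} {f : α → β} {p : α → Prop} : ∀ {l : List β},
    (∀ b ∈ l, ∃ a, p a ∧ f a = b) → ∃ l' : List α, l'.map f = l ∧ ∀ a ∈ l', p a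
  | [], _ => ⟨[], rfl, by simp⟩
  | b :: l, h => by
    obtain ⟨a, ha, rfl⟩ := h b (by simp)
    obtain ⟨l', rfl, hl'⟩ := exists_map_eq fun b hb => h b (List.mem_cons_of_mem _ hb)
    exact ⟨a :: l', rfl, by simpa using ⟨ha, hl'⟩⟩

theorem exists_zip {α β γ : Type*} {g : α → β} : ∀ {l : List α} {cw : List (β × γ)},
    cw.map Prod.fst = l.map g →
      ∃ z : List (α × γ), z.map Prod.fst = l ∧ z.map (Prod.map g id) = cw
  | [], cw, h => ⟨[], rfl, (List.map_eq_nil_iff.1 h).symm⟩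
  | a :: l, cw, h => by
    obtain ⟨⟨b, c⟩, cw, rfl, rfl, h'⟩ := List.map_eq_cons_iff.1 h
    obtain ⟨z, rfl, rfl⟩ := exists_zip h'
    exact ⟨(a, c) :: z, rfl, rfl⟩

theorem mem_unionSizes_of_hasColoring {r : ℕ → ℕ → Prop} {l : List (ℕ × ℕ)} {g : ℕ × ℕ → ℕ}
    (hl : ∀ d ∈ l, d ∈ A ∧ d.1 < i ∧ d.2 < j) (hn : l.Nodup)
    (hstep : l.Pairwise fun d e => r (g d) (g e) → step d e)
    (hcol : HasColoring r k n (l.map g)) : n ∈ unionSizes step A i j k := by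
  obtain ⟨cw, hw, hp, rfl⟩ := hcol
  obtain ⟨z, rfl, rfl⟩ := exists_zip hw
  rw [List.pairwise_map] at hp hstep
  refine ⟨fun t => (z.filter fun u => u.2 = (t : ℕ)).map Prod.fst, fun t => ⟨?_, ?_⟩, ?_⟩
  · refine List.Pairwise.isChain ?_
    rw [List.pairwise_map, List.pairwise_filter]
    refine hp.imp₂ ?_ hstep
    intro u v h1 h2 hu hv
    simp only [decide_eq_true_eq] at hu hv
    exact h2 (h1 (by simp [hu]) (by simp [hu, hv]))
  · intro x hx
    obtain ⟨u, hu, rfl⟩ := List.mem_map.1 hx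
    exact hl _ (List.mem_map_of_mem (List.mem_filter.1 hu).1)
  · have h1 : (Finset.univ.biUnion fun t : Fin k =>
        ((z.filter fun u => u.2 = (t : ℕ)).map Prod.fst).toFinset) =
        ((z.filter fun u => u.2 < k).map Prod.fst).toFinset := by
      ext x
      simp only [Finset.mem_biUnion, Finset.mem_univ, true_and, List.mem_toFinset, List.mem_map,
        List.mem_filter, decide_eq_true_eq]
      constructor
      · rintro ⟨t, u, ⟨hu, hut⟩, rfl⟩
        exact ⟨u, ⟨hu, hut ▸ t.2⟩, rfl⟩
      · rintro ⟨u, ⟨hu, hut⟩, rfl⟩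
        exact ⟨⟨u.2, hut⟩, u, ⟨hu, rfl⟩, rfl⟩
    rw [h1, List.toFinset_card_of_nodup (hn.sublist (List.filter_sublist.map _)), List.length_map,
      List.countP_map, List.countP_eq_length_filter]
    rfl

/-- Reading from bottom to top meets a Se-chain backwards; reversal repairs this. -/
theorem unionSizes_flip_subset (step : ℕ × ℕ → ℕ × ℕ → Prop) (A : Finset (ℕ × ℕ)) (i j k : ℕ) :
    unionSizes (flip step) A i j k ⊆ unionSizes step A i j k := by
  rintro n ⟨C, hC, rfl⟩
  refine ⟨fun t => (C t).reverse, fun t => ⟨?_, fun x hx => (hC t).2 x (List.mem_reverse.1 hx)⟩,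
    by simp⟩
  exact List.isChain_reverse.2 (hC t).1

theorem IsChainIn.pairwise (htr : ∀ x y z, step x y → step y z → step x z) {l : List (ℕ × ℕ)}
    (h : IsChainIn step A i j l) : l.Pairwise step :=
  haveI : IsTrans _ step := ⟨htr⟩
  List.isChain_iff_pairwise.1 h.1

theorem IsChainIn.comparable (htr : ∀ x y z, step x y → step y z → step x z) {l : List (ℕ × ℕ)}
    (h : IsChainIn step A i j l) {x y : ℕ × ℕ} (hx : x ∈ l) (hy : y ∈ l) :
    x = y ∨ step x y ∨ step y x := by
  have h1 : l.Pairwise fun x y => x = y ∨ step x y ∨ step y x :=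
    (h.pairwise htr).imp fun h => Or.inr (Or.inl h)
  exact List.Pairwise.forall_of_forall_of_flip (R := fun x y => x = y ∨ step x y ∨ step y x)
    (fun x _ => Or.inl rfl) h1
    (h1.imp fun h => by simpa only [flip, eq_comm, or_comm] using h) hx hy

theorem stepNE_trans (x y z : ℕ × ℕ) (h : StepNE x y) (h' : StepNE y z) : StepNE x z :=
  ⟨h.1.trans h'.1, h.2.trans h'.2⟩

theorem stepSE_trans (x y z : ℕ × ℕ) (h : StepSE x y) (h' : StepSE y z) : StepSE x z :=
  ⟨h'.1.trans h.1, h.2.trans h'.2⟩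

/-- A nE-chain and a Se-chain have at most one element in common. -/
theorem add_le_of_mem_unionSizes {k' n' : ℕ} (h : n ∈ unionSizes StepNE A i j k)
    (h' : n' ∈ unionSizes StepSE A i j k') :
    n + n' ≤ (A.filter fun d => d.1 < i ∧ d.2 < j).card + k * k' := by
  obtain ⟨C, hC, rfl⟩ := h
  obtain ⟨D, hD, rfl⟩ := h'
  rw [← Finset.card_union_add_card_inter]
  refine add_le_add (Finset.card_le_card ?_) ?_
  · intro x hx
    simp only [Finset.mem_union, Finset.mem_biUnion, Finset.mem_univ, true_and,
      List.mem_toFinset] at hx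
    rw [Finset.mem_filter]
    rcases hx with ⟨t, ht⟩ | ⟨t, ht⟩
    · exact (hC t).2 x ht
    · exact (hD t).2 x ht
  · have h1 : (Finset.univ.biUnion fun t => (C t).toFinset) ∩
        (Finset.univ.biUnion fun t => (D t).toFinset) ⊆
        (Finset.univ : Finset (Fin k × Fin k')).biUnion
          fun p => (C p.1).toFinset ∩ (D p.2).toFinset := by
      intro x hx
      simp only [Finset.mem_inter, Finset.mem_biUnion, Finset.mem_univ, true_and] at hx ⊢
      obtain ⟨⟨t, ht⟩, ⟨s, hs⟩⟩ := hx
      exact ⟨(t, s), ht, hs⟩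
    refine (Finset.card_le_card h1).trans
      ((Finset.card_biUnion_le_card_mul _ _ 1 fun p _ => ?_).trans_eq (by simp))
    refine Finset.card_le_one.2 fun x hx y hy => ?_
    simp only [Finset.mem_inter, List.mem_toFinset] at hx hy
    have h2 := (hC p.1).comparable stepNE_trans hx.1 hy.1
    have h3 := (hD p.2).comparable stepSE_trans hx.2 hy.2
    simp only [StepNE, StepSE] at h2 h3
    rcases h2 with h2 | h2
    · exact h2
    · rcases h3 with h3 | h3
      · exact h3
      · omega

theorem chainLengths_eq_unionSizes (htr : ∀ x y z, step x y → step y z → step x z)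
    (hirr : ∀ x, ¬ step x x) : chainLengths step A i j = unionSizes step A i j 1 := by
  have hnd : ∀ l, IsChainIn step A i j l → l.toFinset.card = l.length := fun l hl =>
    List.toFinset_card_of_nodup ((hl.pairwise htr).imp fun h => by
      rintro rfl
      exact hirr _ h)
  ext n
  constructor
  · rintro ⟨l, hl, rfl⟩
    exact ⟨fun _ => l, fun _ => hl, by simp [hnd l hl]⟩
  · rintro ⟨C, hC, rfl⟩
    exact ⟨C 0, hC 0, by simp [hnd _ (hC 0)]⟩

end Chains

/-! ### Counting the cells of a Young diagram -/

section Cells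

variable (lam : YoungDiagram) (k : ℕ)

theorem sum_rowLen : ∑ t ∈ Finset.range k, lam.rowLen t =
    (lam.cells.filter fun d => d.1 < k).card := by
  rw [Finset.card_eq_sum_card_fiberwise (f := Prod.fst) (t := Finset.range k)
    (fun d hd => by simpa using (Finset.mem_filter.1 hd).2)]
  refine Finset.sum_congr rfl fun t ht => ?_
  rw [YoungDiagram.rowLen_eq_card, YoungDiagram.row, Finset.filter_filter]
  congr 1
  refine Finset.filter_congr fun d _ => ?_
  have := Finset.mem_range.1 ht
  omega

theorem sum_colLen : ∑ t ∈ Finset.range k, lam.colLen t =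
    (lam.cells.filter fun d => d.2 < k).card := by
  rw [Finset.card_eq_sum_card_fiberwise (f := Prod.snd) (t := Finset.range k)
    (fun d hd => by simpa using (Finset.mem_filter.1 hd).2)]
  refine Finset.sum_congr rfl fun t ht => ?_
  rw [YoungDiagram.colLen_eq_card, YoungDiagram.col, Finset.filter_filter]
  congr 1
  refine Finset.filter_congr fun d _ => ?_
  have := Finset.mem_range.1 ht
  omega

/-- Since `(k, l)` is not a cell, every cell lies in the first `k` rows or the first `l` columns;
the cells in both form the full rectangle. -/
theorem card_rows_add_card_cols {k l : ℕ} (h1 : ∀ r < k, ∀ c < l, (r, c) ∈ lam)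
    (h2 : (k, l) ∉ lam) :
    (lam.cells.filter fun d => d.1 < k).card + (lam.cells.filter fun d => d.2 < l).card =
      lam.cells.card + k * l := by
  rw [← Finset.card_union_add_card_inter]
  congr 1
  · congr 1
    ext d
    simp only [Finset.mem_union, Finset.mem_filter, ← and_or_left, and_iff_left_iff_imp]
    intro hd
    by_contra hc
    exact h2 (lam.up_left_mem (i2 := d.1) (j2 := d.2) (by omega) (by omega) ((YoungDiagram.mem_cells d).1 hd))
  · have : (lam.cells.filter fun d => d.1 < k) ∩ (lam.cells.filter fun d => d.2 < l) =
        Finset.range k ×ˢ Finset.range l := by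
      ext d
      simp only [Finset.mem_inter, Finset.mem_filter, Finset.mem_product, Finset.mem_range]
      constructor
      · exact fun h => ⟨h.1.2, h.2.2⟩
      · intro h
        have := (YoungDiagram.mem_cells d).2 (h1 d.1 h.1 d.2 h.2)
        exact ⟨⟨this, h.1⟩, this, h.2⟩
    rw [this, Finset.card_product, Finset.card_range, Finset.card_range]

end Cells

/-- Unions of chains as large as the first rows and columns of the label of a corner exist. -/
theorem IsDualRSKDiagram.exists_chains {F : YoungDiagram} {A : Finset (ℕ × ℕ)}
    {L : ℕ → ℕ → YoungDiagram} (hL : IsDualRSKDiagram F A L) {i j : ℕ} (hc : IsCorner F i j) :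
    (L i j).cells.card = (A.filter fun d => d.1 < i ∧ d.2 < j).card ∧
    (∀ k, ((L i j).cells.filter fun d => d.1 < k).card ∈ unionSizes StepNE A i j k) ∧
    (∀ k, ((L i j).cells.filter fun d => d.2 < k).card ∈ unionSizes StepSE A i j k) := by
  obtain ⟨M, hM, hML⟩ := hL
  rw [hML i j hc]
  have hX := isPartialPermutation_image_separate A
  set Q := colLine A j
  obtain ⟨l, hl, hmem, hword⟩ := exists_greeneLE_tableauWord hX Q (rowLine A i)
  obtain ⟨l, rfl, hlA⟩ := exists_map_eq (f := separate A) (p := fun d => d ∈ A) (l := l)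
    fun b hb => Finset.mem_image.1 ((hmem b).1 hb).1
  have hlab := hM.edgeLabel hX (P := rowLine A i) (Q := Q)
    (fun p hp q hq => mem_augmentedShape hc hp hq) _ le_rfl
  -- The bound `Q` on the labels ensures that the word with `Q` rows omits no letter.
  have hN : ∀ c < Q, edgeRow (A.image (separate A)) (rowLine A i) c ≤ Q :=
    fun c hcQ => (edgeRow_le _ _ c).trans hcQ
  have h0 := hM.left (rowLine A i)
  rw [List.pairwise_map] at hl
  have hnd : l.Nodup := hl.imp fun h => by rintro rfl; exact lt_irrefl _ h
  have hrect : ∀ d ∈ l, d ∈ A ∧ d.1 < i ∧ d.2 < j := fun d hd => by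
    have h1 := (hmem _).1 (List.mem_map_of_mem hd)
    exact ⟨hlA d hd, (separate_fst_lt_iff (hlA d hd)).1 h1.2.1,
      (separate_snd_lt_iff (hlA d hd)).1 h1.2.2⟩
  have hlen := hword.1
  rw [length_tableauWord h0 hlab hN, List.length_map, List.length_map] at hlen
  rw [List.map_map] at hword
  refine ⟨?_, fun k => ?_, fun k => ?_⟩
  · rw [hlen, ← List.toFinset_card_of_nodup hnd]
    congr 1
    ext d
    rw [List.mem_toFinset, Finset.mem_filter]
    refine ⟨hrect d, fun hd => ?_⟩
    obtain ⟨e, he, hed⟩ := List.mem_map.1 ((hmem (separate A d)).2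
      ⟨Finset.mem_image_of_mem _ hd.1, (separate_fst_lt_iff hd.1).2 hd.2.1,
        (separate_snd_lt_iff hd.1).2 hd.2.2⟩)
    rwa [← eq_of_separate_eq (hlA e he) hd.1 (Or.inl (by rw [hed]))]
  · have h1 := (hword.2 [] [] k _).1 (by simpa using hasColoring_rows h0 hlab hN k)
    simp only [List.nil_append, List.append_nil] at h1
    refine mem_unionSizes_of_hasColoring hrect hnd (hl.imp_of_mem ?_) h1
    -- Ties are excluded on one side only: two crosses from one row never increase, whereas two from
    -- one column do.
    intro d e hd he h2 h3
    have h4 := fst_le_of_separate_fst_lt (hlA e he) h2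
    have h5 := snd_le_of_separate_snd_lt (hlA e he) h3
    simp only [StepNE]
    omega
  · have h1 := (hword.2 [] [] k _).2 (by simpa using hasColoring_columns h0 hlab hN k)
    simp only [List.nil_append, List.append_nil] at h1
    refine unionSizes_flip_subset _ _ _ _ _
      (mem_unionSizes_of_hasColoring hrect hnd (hl.imp_of_mem ?_) h1)
    intro d e hd he h2 h3
    have h4 := fst_le_of_separate_fst_lt (hlA e he) h2
    have h5 := snd_le_of_separate_snd_lt (hlA d hd) h3
    simp only [flip, StepSE]
    omega

end DualRSK

theorem theorem10 (F : YoungDiagram) (A : Finset (ℕ × ℕ)) (hA : A ⊆ F.cells)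
    (L : ℕ → ℕ → YoungDiagram) (hL : DualRSK.IsDualRSKDiagram F A L)
    (i j : ℕ) (hc : DualRSK.IsCorner F i j) :
    (∀ k : ℕ, IsGreatest (DualRSK.unionSizes DualRSK.StepNE A i j k)
      (∑ t ∈ Finset.range k, (L i j).rowLen t)) ∧
    (∀ k : ℕ, IsGreatest (DualRSK.unionSizes DualRSK.StepSE A i j k)
      (∑ t ∈ Finset.range k, (L i j).colLen t)) ∧
    IsGreatest (DualRSK.chainLengths DualRSK.StepNE A i j) ((L i j).rowLen 0) ∧
    IsGreatest (DualRSK.chainLengths DualRSK.StepSE A i j) ((L i j).colLen 0) := by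
  obtain ⟨hcard, hNE, hSE⟩ := hL.exists_chains hc
  have h1 : ∀ k : ℕ, IsGreatest (DualRSK.unionSizes DualRSK.StepNE A i j k)
      (∑ t ∈ Finset.range k, (L i j).rowLen t) := by
    intro k
    rw [DualRSK.sum_rowLen]
    refine ⟨hNE k, fun n hn => ?_⟩
    -- With the length of row `k` (counted from `0`) as the number of Se-chains, `(k, (L i j).rowLen
    -- k)` is the first position outside row `k`, so the duality bound is sharp.
    have h2 := DualRSK.add_le_of_mem_unionSizes hn (hSE ((L i j).rowLen k))
    have h3 := DualRSK.card_rows_add_card_cols (L i j) (k := k) (l := (L i j).rowLen k)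
      (fun r hr c hc => YoungDiagram.mem_iff_lt_rowLen.2
        (hc.trans_le ((L i j).rowLen_anti r k hr.le)))
      (by simp [YoungDiagram.mem_iff_lt_rowLen])
    omega
  have h2 : ∀ k : ℕ, IsGreatest (DualRSK.unionSizes DualRSK.StepSE A i j k)
      (∑ t ∈ Finset.range k, (L i j).colLen t) := by
    intro k
    rw [DualRSK.sum_colLen]
    refine ⟨hSE k, fun n hn => ?_⟩
    have h2 := DualRSK.add_le_of_mem_unionSizes (hNE ((L i j).colLen k)) hn
    have h3 := DualRSK.card_rows_add_card_cols (L i j) (k := (L i j).colLen k) (l := k)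
      (fun r hr c hc => YoungDiagram.mem_iff_lt_colLen.2
        (hr.trans_le ((L i j).colLen_anti c k hc.le)))
      (by simp [YoungDiagram.mem_iff_lt_colLen])
    omega
  refine ⟨h1, h2, ?_, ?_⟩
  · rw [DualRSK.chainLengths_eq_unionSizes DualRSK.stepNE_trans fun x h => lt_irrefl _ h.1]
    simpa using h1 1
  · rw [DualRSK.chainLengths_eq_unionSizes DualRSK.stepSE_trans fun x h => lt_irrefl _ h.2]
    simpa using h2 1
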